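/- Let $\mathbb{K}=\mathbb{R}$ or $\mathbb{C}$. For a real number $r\ge 0$ let $\mathcal{C}^{0,r}[0,1]$ be the space of all functions $f\colon[0,1]\to\mathbb{K}$ with $$\|f\|_{\mathcal{C}^{0,r}}=\sup_{x\in[0,1]}|f(x)|+\sup_{x\ne y}\frac{|f(x)-f(y)|}{|x-y|^{r}}<\infty ,$$ endowed with this norm. (Thus $\mathcal{C}^{0,0}[0,1]$ is the space of all bounded functions, and $\mathcal{C}^{0,r}[0,1]$ consists of the constant functions when $r>1$.) For cardinals $\kappa<\mu$, a subset $A$ of a topological vector space $V$ is called $(\kappa,\mu)$-spaceable if there is a $\kappa$-dimensional subspace $F$ of $V$ with $F\subseteq A\cup\{0\}$, and every such subspace $F$ is contained in a closed $\mu$-dimensional subspace $G$ of $V$ with $G\subseteq A\cup\{0\}$. (Dimensions are algebraic; $A$ is not $(\kappa,\mu)$-spaceable when $\kappa\ge\mu$.) Let $\mathfrak{c}$ be the cardinality of the continuum. Let $\alpha\in[0,1]$. Then, for every cardinal $\kappa$, the set $$\mathcal{C}^{0,\alpha}[0,1]\smallsetminus\bigcup_{\beta>\alpha}\mathcal{C}^{0,\beta}[0,1]$$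 is $(\kappa,\mathfrak{c})$-spaceable in $\mathcal{C}^{0,\alpha}[0,1]$ if and only if $\kappa<\aleph_0$. Here $\beta$ runs over all real numbers greater than $\alpha$; for $\alpha<1$ the union is the same as the one over $\beta\in(\alpha,1]$, and for $\alpha=1$ it is the space of constant functions. -/

import Mathlib

open scoped NNReal Cardinal

universe u

/-- A subset `A` of a vector space `V` is `κ`-lineable if there is a subspace `F` of `V` of
(Hamel) dimension `κ` with `F \ {0} ⊆ A`. -/
def IsLineable (𝕜 : Type*) {V : Type u} [Field 𝕜] [AddCommGroup V] [Module 𝕜 V]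
    (κ : Cardinal.{u}) (A : Set V) : Prop :=
  ∃ F : Submodule 𝕜 V, Module.rank 𝕜 F = κ ∧ (F : Set V) \ {0} ⊆ A

/-- For cardinals `κ < μ`, a subset `A` of a topological vector space `V` is `(κ, μ)`-spaceable
if it is `κ`-lineable and every `κ`-dimensional subspace contained in `A ∪ {0}` lies in some
closed `μ`-dimensional subspace contained in `A ∪ {0}`. (The requirement `μ ≤ dim V` is implied,
since a `μ`-dimensional subspace exists.) -/
def IsPairSpaceable (𝕜 : Type*) {V : Type u} [Field 𝕜] [AddCommGroup V] [Module 𝕜 V]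
    [TopologicalSpace V] (κ μ : Cardinal.{u}) (A : Set V) : Prop :=
  κ < μ ∧ IsLineable 𝕜 κ A ∧
    ∀ F : Submodule 𝕜 V, Module.rank 𝕜 F = κ → (F : Set V) ⊆ A ∪ {0} →
      ∃ G : Submodule 𝕜 V, Module.rank 𝕜 G = μ ∧ IsClosed (G : Set V) ∧ F ≤ G ∧
        (G : Set V) ⊆ A ∪ {0}

section Holder

variable (𝕜 X E : Type*) [NormedField 𝕜] [MetricSpace X] [NormedAddCommGroup E] [NormedSpace 𝕜 E]

/-- The subspace of all functions `f : X → E` that are bounded and have a finite Hölder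
seminorm of order `r`, that is, whose Hölder norm of order `r` is finite. For `r = 0` these are
all bounded functions. -/
def holderSubmodule (r : ℝ≥0) : Submodule 𝕜 (X → E) where
  carrier := {f | (∃ C : ℝ, ∀ x, ‖f x‖ ≤ C) ∧ MemHolder r f}
  zero_mem' := ⟨⟨0, fun x => by simp⟩, memHolder_zero⟩
  add_mem' := by
    rintro f g ⟨⟨C, hC⟩, hf⟩ ⟨⟨D, hD⟩, hg⟩
    exact ⟨⟨C + D, fun x => (norm_add_le _ _).trans (add_le_add (hC x) (hD x))⟩, hf.add hg⟩
  smul_mem' := by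
    rintro c f ⟨⟨C, hC⟩, hf⟩
    refine ⟨⟨‖c‖ * C, fun x => ?_⟩, hf.smul⟩
    rw [Pi.smul_apply, norm_smul]
    exact mul_le_mul_of_nonneg_left (hC x) (norm_nonneg c)

/-- The Hölder space `C^{0,r}(X, E)`. It is a type of its own, so that its topology is the one
of the Hölder norm below and not that of pointwise convergence. -/
def HolderSpace (r : ℝ≥0) : Type _ := ↥(holderSubmodule 𝕜 X E r)

namespace HolderSpace

variable {𝕜 X E} {r : ℝ≥0}

instance instAddCommGroup : AddCommGroup (HolderSpace 𝕜 X E r) :=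
  inferInstanceAs (AddCommGroup (holderSubmodule 𝕜 X E r))

instance instModule : Module 𝕜 (HolderSpace 𝕜 X E r) :=
  inferInstanceAs (Module 𝕜 (holderSubmodule 𝕜 X E r))

/-- The function underlying an element of the Hölder space. -/
def toFun (f : HolderSpace 𝕜 X E r) : X → E := f.1

/-- The Hölder norm `sup_x ‖f x‖ + [f]_r`; here `nnHolderNorm r f` is the Hölder seminorm, the
least `C ≥ 0` such that `‖f x - f y‖ ≤ C * d(x, y) ^ r` for all `x`, `y`. -/
noncomputable instance instNorm : Norm (HolderSpace 𝕜 X E r) :=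
  ⟨fun f => (⨆ x, ‖f.toFun x‖) + (nnHolderNorm r f.toFun : ℝ)⟩

theorem norm_def (f : HolderSpace 𝕜 X E r) :
    ‖f‖ = (⨆ x, ‖f.toFun x‖) + (nnHolderNorm r f.toFun : ℝ) := rfl

theorem memHolder (f : HolderSpace 𝕜 X E r) : MemHolder r f.toFun := f.2.2

theorem bddAbove (f : HolderSpace 𝕜 X E r) : BddAbove (Set.range fun x => ‖f.toFun x‖) := by
  obtain ⟨C, hC⟩ := f.2.1
  exact ⟨C, by rintro _ ⟨x, rfl⟩; exact hC x⟩

theorem sup_nonneg (f : HolderSpace 𝕜 X E r) : 0 ≤ ⨆ x, ‖f.toFun x‖ :=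
  Real.iSup_nonneg fun _ => norm_nonneg _

theorem toFun_add (f g : HolderSpace 𝕜 X E r) : (f + g).toFun = f.toFun + g.toFun := rfl

theorem toFun_smul (c : 𝕜) (f : HolderSpace 𝕜 X E r) : (c • f).toFun = c • f.toFun := rfl

theorem norm_smul_eq (c : 𝕜) (f : HolderSpace 𝕜 X E r) : ‖c • f‖ = ‖c‖ * ‖f‖ := by
  rw [norm_def, norm_def, toFun_smul, f.memHolder.nnHolderNorm_smul, mul_add,
    Real.mul_iSup_of_nonneg (norm_nonneg c)]
  simp only [Pi.smul_apply, norm_smul, NNReal.coe_mul, coe_nnnorm]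

theorem norm_triangle (f g : HolderSpace 𝕜 X E r) : ‖f + g‖ ≤ ‖f‖ + ‖g‖ := by
  have h1 : (⨆ x, ‖(f + g).toFun x‖) ≤ (⨆ x, ‖f.toFun x‖) + ⨆ x, ‖g.toFun x‖ := by
    refine Real.iSup_le (fun x => ?_) (add_nonneg f.sup_nonneg g.sup_nonneg)
    exact (norm_add_le _ _).trans (add_le_add (le_ciSup f.bddAbove x) (le_ciSup g.bddAbove x))
  have h2 : (nnHolderNorm r (f + g).toFun : ℝ)
      ≤ nnHolderNorm r f.toFun + nnHolderNorm r g.toFun :=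
    mod_cast f.memHolder.nnHolderNorm_add_le g.memHolder
  rw [norm_def, norm_def, norm_def]
  linarith

theorem eq_zero_of_norm (f : HolderSpace 𝕜 X E r) (h : ‖f‖ = 0) : f = 0 := by
  have h0 : (⨆ x, ‖f.toFun x‖) ≤ 0 := by
    rw [norm_def] at h
    linarith [(nnHolderNorm r f.toFun).coe_nonneg]
  refine Subtype.ext (funext fun x => ?_)
  exact norm_le_zero_iff.1 ((le_ciSup f.bddAbove x).trans h0)

theorem core : NormedSpace.Core 𝕜 (HolderSpace 𝕜 X E r) where
  norm_nonneg f := add_nonneg f.sup_nonneg (NNReal.coe_nonneg _)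
  norm_smul := norm_smul_eq
  norm_triangle := norm_triangle
  norm_eq_zero_iff f := by
    refine ⟨eq_zero_of_norm f, ?_⟩
    rintro rfl
    simpa using norm_smul_eq (0 : 𝕜) (0 : HolderSpace 𝕜 X E r)

noncomputable instance instNormedAddCommGroup : NormedAddCommGroup (HolderSpace 𝕜 X E r) :=
  NormedAddCommGroup.ofCore core

noncomputable instance instNormedSpace : NormedSpace 𝕜 (HolderSpace 𝕜 X E r) :=
  NormedSpace.ofCore core

end HolderSpace

/-- The functions in `C^{0,α}[0,1]` that lie in no `C^{0,β}[0,1]` with `β > α`, as a subset of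
`C^{0,α}[0,1]`. -/
def strictHolderSet (α : ℝ≥0) : Set (HolderSpace 𝕜 (Set.Icc (0 : ℝ) 1) 𝕜 α) :=
  {f | f.toFun ∉ ⋃ β > α, (holderSubmodule 𝕜 (Set.Icc (0 : ℝ) 1) 𝕜 β : Set _)}

end Holder

/-! On `[0,1]` Hölder conditions weaken as the exponent drops, so the functions of order better than
`α` form a linear subspace `I = improvedOn 𝕜 α univ`, and the question concerns subspaces meeting
`I` only in zero.

Let `F` be such a subspace of finite dimension `n`. Cut `[0,1]` into `n + 1` intervals. A member of
`F` improved on every piece lies in `I`, hence is zero; by a dimension count `n` of the pieces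
already force this, so one piece is free (`exists_interval_eq_zero_of_improvedOn`). Inside it put a
sequence of adjacent bumps of exact order `α`. They give a closed space `B` of dimension `𝔠` with `B
∩ I = 0`, and `B + F` is closed because `F` is finite-dimensional. If `g + f ∈ I`, then `f` is
improved off the free piece, where `g` vanishes; so `f = 0`, and then `g = 0`.

If `F` is infinite-dimensional, take a functional `φ` equal to `1` at arbitrarily small vectors and
replace `F` by `{x + φ x • 1}`. Constants lie in `I`, so dimension and trivial intersection with `I`
persist, but the closure now contains `1` (`exists_rank_eq_not_isClosed`). -/

/-! ### Linear algebra and dimension counts -/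

/-- Finitely many subspaces of a finite-dimensional space have the same intersection as some
subfamily with at most `dim V` members. -/
theorem Submodule.exists_subset_finset_inf_eq {K V ι : Type*} [Field K] [AddCommGroup V]
    [Module K V] [FiniteDimensional K V] (W : ι → Submodule K V) (s : Finset ι) :
    ∃ t ⊆ s, t.card + Module.finrank K (t.inf W : Submodule K V) ≤ Module.finrank K V ∧
      t.inf W = s.inf W := by
  classical
  induction s using Finset.induction_on with
  | empty => exact ⟨∅, subset_rfl, by simpa using Submodule.finrank_le _, rfl⟩
  | insert i s hi ih =>
    obtain ⟨t, hts, hcard, hinf⟩ := ih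
    by_cases h : t.inf W ≤ W i
    · refine ⟨t, hts.trans (Finset.subset_insert _ _), hcard, ?_⟩
      rw [Finset.inf_insert, ← hinf, inf_eq_right.2 h]
    · refine ⟨insert i t, Finset.insert_subset_insert _ hts, ?_, ?_⟩
      -- A member is kept only if it shrinks the intersection, so the drop in dimension pays for it.
      · have hlt : W i ⊓ t.inf W < t.inf W := inf_lt_right.2 h
        have := Submodule.finrank_lt_finrank_of_lt hlt
        rw [Finset.inf_insert, Finset.card_insert_of_notMem fun hit => hi (hts hit)]
        omega
      · rw [Finset.inf_insert, Finset.inf_insert, hinf]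

/-- On an infinite-dimensional normed space there is a linear functional that takes the value `1`
at arbitrarily small vectors. -/
theorem exists_linearMap_eq_one_norm_lt {𝕜 E : Type*} [RCLike 𝕜] [NormedAddCommGroup E]
    [NormedSpace 𝕜 E] (h : ℵ₀ ≤ Module.rank 𝕜 E) :
    ∃ φ : E →ₗ[𝕜] 𝕜, ∀ ε > 0, ∃ x, ‖x‖ < ε ∧ φ x = 1 := by
  let b := Module.Basis.ofVectorSpace 𝕜 E
  rw [← b.mk_eq_rank''] at h
  have := Cardinal.infinite_iff.2 h
  let e := Infinite.natEmbedding (Module.Basis.ofVectorSpaceIndex 𝕜 E)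
  -- With `φ (b (e n)) = c n`, the vector `(c n)⁻¹ • b (e n)` has norm `1 / (n + 1)` and value `1`.
  let c : ℕ → 𝕜 := fun n => (((n + 1 : ℝ) * ‖b (e n)‖ : ℝ) : 𝕜)
  refine ⟨b.constr 𝕜 (Function.extend e c 0), fun ε hε => ?_⟩
  obtain ⟨n, hn⟩ := exists_nat_one_div_lt hε
  have hb : 0 < ‖b (e n)‖ := norm_pos_iff.2 (b.ne_zero _)
  have hc : c n ≠ 0 := by
    simp only [c]
    exact_mod_cast (by positivity : ((n + 1 : ℝ) * ‖b (e n)‖ : ℝ) ≠ 0)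
  refine ⟨(c n)⁻¹ • b (e n), ?_, ?_⟩
  · have hcn : ‖c n‖ = (n + 1 : ℝ) * ‖b (e n)‖ := by
      simp only [c]
      rw [RCLike.norm_ofReal, abs_of_pos (by positivity)]
    rw [norm_smul, norm_inv, hcn]
    refine lt_of_eq_of_lt ?_ hn
    field_simp
  · rw [map_smul, b.constr_basis, e.injective.extend_apply, smul_eq_mul, inv_mul_cancel₀ hc]

/-- A vector space contains a subspace of every dimension up to its own. -/
theorem Submodule.exists_le_rank_eq {K : Type*} {V : Type u} [Field K] [AddCommGroup V]
    [Module K V] (G : Submodule K V) {κ : Cardinal.{u}} (h : κ ≤ Module.rank K G) :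
    ∃ F ≤ G, Module.rank K F = κ := by
  obtain ⟨s, hs, hind⟩ := le_rank_iff_exists_linearIndependent.1 h
  refine ⟨(Submodule.span K s).map G.subtype, Submodule.map_subtype_le _ _, ?_⟩
  rw [LinearEquiv.rank_eq (Submodule.equivMapOfInjective _ G.injective_subtype _).symm,
    rank_span_set hind, hs]

theorem RCLike.mk_le_continuum (𝕜 : Type u) [RCLike 𝕜] : #𝕜 ≤ 𝔠 := by
  have hinj : Function.Injective fun z : 𝕜 => (RCLike.re z, RCLike.im z) := fun z w h =>
    RCLike.ext (Prod.ext_iff.1 h).1 (Prod.ext_iff.1 h).2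
  simpa [Cardinal.mk_prod, Cardinal.mk_real] using Cardinal.lift_mk_le_lift_mk_of_injective hinj

theorem rank_nat_fun_le_continuum (𝕜 : Type u) [RCLike 𝕜] : Module.rank 𝕜 (ℕ → 𝕜) ≤ 𝔠 := by
  refine (rank_le_card _ _).trans ?_
  rw [Cardinal.mk_arrow, Cardinal.mk_nat, Cardinal.lift_aleph0, Cardinal.lift_uzero]
  exact (Cardinal.power_le_power_right (RCLike.mk_le_continuum 𝕜)).trans
    Cardinal.continuum_power_aleph0.le

/-- The geometric sequences with distinct ratios are linearly independent. -/
theorem linearIndependent_geometric (𝕜 : Type u) [RCLike 𝕜] :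
    LinearIndependent 𝕜 fun (t : Set.Ioo (0 : ℝ) 1) (k : ℕ) => ((t : ℝ) : 𝕜) ^ k := by
  -- Geometric sequences are eigenvectors of the shift for distinct eigenvalues.
  let shift : Module.End 𝕜 (ℕ → 𝕜) := LinearMap.funLeft 𝕜 𝕜 Nat.succ
  refine shift.eigenvectors_linearIndependent' (fun t : Set.Ioo (0 : ℝ) 1 => ((t : ℝ) : 𝕜))
    (fun s t h => Subtype.ext (RCLike.ofReal_injective h)) _ fun t => ⟨?_, fun h => ?_⟩
  · rw [Module.End.mem_eigenspace_iff]
    ext k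
    simp [shift, LinearMap.funLeft_apply, pow_succ']
  · simpa using congrFun h 0

/-! ### Elementary estimates -/

theorem Real.abs_rpow_sub_rpow_le {a b r : ℝ} (ha : 0 ≤ a) (hb : 0 ≤ b) (hr : 0 ≤ r)
    (hr1 : r ≤ 1) : |a ^ r - b ^ r| ≤ |a - b| ^ r := by
  wlog hab : b ≤ a generalizing a b
  · rw [abs_sub_comm, abs_sub_comm a]
    exact this hb ha (le_of_not_ge hab)
  have h := Real.rpow_add_le_add_rpow hb (sub_nonneg.2 hab) hr hr1
  rw [add_sub_cancel] at h
  rw [abs_of_nonneg (sub_nonneg.2 (Real.rpow_le_rpow hb hab hr)),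
    abs_of_nonneg (sub_nonneg.2 hab)]
  linarith

theorem unitInterval_dist_le_one (x y : Set.Icc (0 : ℝ) 1) : dist x y ≤ 1 := by
  rw [Subtype.dist_eq, Real.dist_eq, abs_le]
  constructor <;> linarith [x.2.1, x.2.2, y.2.1, y.2.2]

/-! ### Functions of better Hölder regularity on a part of the unit interval -/

section Improved

variable (𝕜 : Type u) [RCLike 𝕜]

/-- The functions that satisfy on `S ∩ [0,1]` a Hölder condition of some order larger
than `α`. -/
def improvedOn (α : ℝ≥0) (S : Set ℝ) : Submodule 𝕜 (Set.Icc (0 : ℝ) 1 → 𝕜) where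
  carrier := {f | ∃ β > α, ∃ C : ℝ, 0 ≤ C ∧ ∀ x y : Set.Icc (0 : ℝ) 1, (x : ℝ) ∈ S → (y : ℝ) ∈ S →
    ‖f x - f y‖ ≤ C * dist x y ^ (β : ℝ)}
  zero_mem' := ⟨α + 1, by simp, 0, le_rfl, by simp⟩
  add_mem' := by
    rintro f g ⟨β, hβ, C, hC, hf⟩ ⟨γ, hγ, D, hD, hg⟩
    refine ⟨min β γ, lt_min hβ hγ, C + D, add_nonneg hC hD, fun x y hx hy => ?_⟩
    -- Distances are at most one, so lowering the exponent only weakens the bound.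
    have hle : ∀ δ : ℝ≥0, min β γ ≤ δ →
        dist x y ^ (δ : ℝ) ≤ dist x y ^ ((min β γ : ℝ≥0) : ℝ) := fun δ hδ =>
      Real.rpow_le_rpow_of_exponent_ge' dist_nonneg (unitInterval_dist_le_one x y)
        (NNReal.coe_nonneg _) hδ
    calc ‖(f + g) x - (f + g) y‖ = ‖(f x - f y) + (g x - g y)‖ := by
          simp only [Pi.add_apply]; congr 1; ring
      _ ≤ ‖f x - f y‖ + ‖g x - g y‖ := norm_add_le _ _
      _ ≤ C * dist x y ^ (β : ℝ) + D * dist x y ^ (γ : ℝ) := add_le_add (hf x y hx hy) (hg x y hx hy)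
      _ ≤ C * dist x y ^ ((min β γ : ℝ≥0) : ℝ) + D * dist x y ^ ((min β γ : ℝ≥0) : ℝ) :=
          add_le_add (mul_le_mul_of_nonneg_left (hle β (min_le_left _ _)) hC)
            (mul_le_mul_of_nonneg_left (hle γ (min_le_right _ _)) hD)
      _ = _ := by ring
  smul_mem' := by
    rintro c f ⟨β, hβ, C, hC, hf⟩
    refine ⟨β, hβ, ‖c‖ * C, by positivity, fun x y hx hy => ?_⟩
    rw [Pi.smul_apply, Pi.smul_apply, ← smul_sub, norm_smul, mul_assoc]
    exact mul_le_mul_of_nonneg_left (hf x y hx hy) (norm_nonneg c)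

variable {𝕜} {α : ℝ≥0} {f : Set.Icc (0 : ℝ) 1 → 𝕜}

theorem improvedOn_mono {S T : Set ℝ} (h : S ⊆ T) : improvedOn 𝕜 α T ≤ improvedOn 𝕜 α S := by
  rintro f ⟨β, hβ, C, hC, hf⟩
  exact ⟨β, hβ, C, hC, fun x y hx hy => hf x y (h hx) (h hy)⟩

theorem mem_improvedOn_of_eq_const {S : Set ℝ} {c : 𝕜}
    (h : ∀ x : Set.Icc (0 : ℝ) 1, (x : ℝ) ∈ S → f x = c) : f ∈ improvedOn 𝕜 α S := by
  refine ⟨α + 1, by simp, 0, le_rfl, fun x y hx hy => ?_⟩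
  simp [h x hx, h y hy]

/-- Points on opposite sides of `c` are compared through `c`, which is no farther from either than
they are from each other. -/
theorem mem_improvedOn_Iic_of_Icc {c d : ℝ} (hc : c ∈ Set.Icc (0 : ℝ) 1)
    (h₁ : f ∈ improvedOn 𝕜 α (Set.Iic c)) (h₂ : f ∈ improvedOn 𝕜 α (Set.Icc c d)) :
    f ∈ improvedOn 𝕜 α (Set.Iic d) := by
  obtain ⟨β, hβ, C, hC, hf⟩ := h₁
  obtain ⟨γ, hγ, D, hD, hg⟩ := h₂
  have hle : ∀ x y : Set.Icc (0 : ℝ) 1, ∀ δ : ℝ≥0, min β γ ≤ δ →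
      dist x y ^ (δ : ℝ) ≤ dist x y ^ ((min β γ : ℝ≥0) : ℝ) := fun x y δ hδ =>
    Real.rpow_le_rpow_of_exponent_ge' dist_nonneg (unitInterval_dist_le_one x y)
      (NNReal.coe_nonneg _) hδ
  have hf' : ∀ x y : Set.Icc (0 : ℝ) 1, (x : ℝ) ≤ c → (y : ℝ) ≤ c →
      ‖f x - f y‖ ≤ C * dist x y ^ ((min β γ : ℝ≥0) : ℝ) := fun x y hx hy =>
    (hf x y hx hy).trans (mul_le_mul_of_nonneg_left (hle x y β (min_le_left _ _)) hC)
  have hg' : ∀ x y : Set.Icc (0 : ℝ) 1, (x : ℝ) ∈ Set.Icc c d → (y : ℝ) ∈ Set.Icc c d →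
      ‖f x - f y‖ ≤ D * dist x y ^ ((min β γ : ℝ≥0) : ℝ) := fun x y hx hy =>
    (hg x y hx hy).trans (mul_le_mul_of_nonneg_left (hle x y γ (min_le_right _ _)) hD)
  refine ⟨min β γ, lt_min hβ hγ, C + D, add_nonneg hC hD, fun x y hx hy => ?_⟩
  wlog hxy : x ≤ y generalizing x y
  · rw [norm_sub_rev, dist_comm]
    exact this y x hy hx (le_of_not_ge hxy)
  have hxy' : (x : ℝ) ≤ y := hxy
  have hpos : 0 ≤ dist x y ^ ((min β γ : ℝ≥0) : ℝ) := Real.rpow_nonneg dist_nonneg _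
  rcases le_total (y : ℝ) c with hyc | hyc
  · nlinarith [hf' x y (hxy'.trans hyc) hyc, mul_nonneg hD hpos]
  rcases le_total c (x : ℝ) with hxc | hxc
  · nlinarith [hg' x y ⟨hxc, hx⟩ ⟨hyc, hy⟩, mul_nonneg hC hpos]
  have h₁ : dist x ⟨c, hc⟩ ≤ dist x y := by
    rw [Subtype.dist_eq, Subtype.dist_eq, Real.dist_eq, Real.dist_eq, abs_sub_comm,
      abs_sub_comm (x : ℝ), abs_of_nonneg (by simpa using hxc), abs_of_nonneg (by linarith)]
    exact sub_le_sub_right hyc _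
  have h₂ : dist ⟨c, hc⟩ y ≤ dist x y := by
    rw [Subtype.dist_eq, Subtype.dist_eq, Real.dist_eq, Real.dist_eq, abs_sub_comm,
      abs_sub_comm (x : ℝ), abs_of_nonneg (by simpa using hyc), abs_of_nonneg (by linarith)]
    exact sub_le_sub_left hxc _
  calc ‖f x - f y‖ = ‖(f x - f ⟨c, hc⟩) + (f ⟨c, hc⟩ - f y)‖ := by congr 1; ring
    _ ≤ ‖f x - f ⟨c, hc⟩‖ + ‖f ⟨c, hc⟩ - f y‖ := norm_add_le _ _
    _ ≤ C * dist x ⟨c, hc⟩ ^ ((min β γ : ℝ≥0) : ℝ) +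
        D * dist ⟨c, hc⟩ y ^ ((min β γ : ℝ≥0) : ℝ) :=
      add_le_add (hf' _ _ hxc le_rfl) (hg' _ _ ⟨le_rfl, hyc.trans hy⟩ ⟨hyc, hy⟩)
    _ ≤ C * dist x y ^ ((min β γ : ℝ≥0) : ℝ) + D * dist x y ^ ((min β γ : ℝ≥0) : ℝ) := by
      gcongr
    _ = _ := by ring

/-- Better regularity on each of the intervals of an equal subdivision is better regularity on
the whole unit interval. -/
theorem mem_improvedOn_univ_of_subdivision {M : ℕ} (hM : 0 < M)
    (h : ∀ j < M, f ∈ improvedOn 𝕜 α (Set.Icc (j / M : ℝ) ((j + 1 : ℕ) / M))) :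
    f ∈ improvedOn 𝕜 α Set.univ := by
  have hM' : (0 : ℝ) < M := by exact_mod_cast hM
  have key : ∀ j ≤ M, f ∈ improvedOn 𝕜 α (Set.Iic (j / M : ℝ)) := by
    intro j
    induction j with
    | zero =>
      intro _
      refine mem_improvedOn_of_eq_const (c := f ⟨0, by simp⟩) fun x hx => congrArg f ?_
      exact Subtype.ext (le_antisymm (by simpa using hx) x.2.1)
    | succ j ih =>
      intro hj
      refine mem_improvedOn_Iic_of_Icc ⟨by positivity, ?_⟩ (ih (by omega)) (h j (by omega))
      rw [div_le_one hM']
      exact_mod_cast (by omega : j ≤ M)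
  have h1 := key M le_rfl
  rw [div_self hM'.ne'] at h1
  obtain ⟨β, hβ, C, hC, hf⟩ := h1
  exact ⟨β, hβ, C, hC, fun x y _ _ => hf x y x.2.2 y.2.2⟩

theorem memHolder_of_norm_sub_le {X : Type*} [MetricSpace X] {g : X → 𝕜} {r : ℝ≥0} {C : ℝ}
    (hC : 0 ≤ C) (h : ∀ x y, ‖g x - g y‖ ≤ C * dist x y ^ (r : ℝ)) : MemHolder r g := by
  lift C to ℝ≥0 using hC
  refine ⟨C, fun x y => ?_⟩
  have := h x y
  rw [← dist_eq_norm, dist_nndist, dist_nndist] at this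
  rw [edist_nndist, edist_nndist, ← ENNReal.coe_rpow_of_nonneg _ r.coe_nonneg,
    ← ENNReal.coe_mul, ENNReal.coe_le_coe]
  exact_mod_cast this

/-- Boundedness is inherited from the ambient space, so only the Hölder condition of higher order
matters. -/
theorem mem_strictHolderSet_iff {f : HolderSpace 𝕜 (Set.Icc (0 : ℝ) 1) 𝕜 α} :
    f ∈ strictHolderSet 𝕜 α ↔ f.toFun ∉ improvedOn 𝕜 α Set.univ := by
  refine not_congr ?_
  simp only [Set.mem_iUnion]
  constructor
  · rintro ⟨β, hβ, -, C, hC⟩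
    refine ⟨β, hβ, C, C.coe_nonneg, fun x y _ _ => ?_⟩
    rw [← dist_eq_norm]
    exact hC.dist_le_of_le le_rfl
  · rintro ⟨β, hβ, C, hC, hf⟩
    exact ⟨β, hβ, f.2.1, memHolder_of_norm_sub_le hC fun x y => hf x y trivial trivial⟩

namespace HolderSpace

theorem ext_toFun {f g : HolderSpace 𝕜 (Set.Icc (0 : ℝ) 1) 𝕜 α} (h : f.toFun = g.toFun) : f = g :=
  Subtype.ext h

variable (𝕜 α) in
/-- The inclusion of the Hölder space into the space of all functions. -/
def toFunLinear : HolderSpace 𝕜 (Set.Icc (0 : ℝ) 1) 𝕜 α →ₗ[𝕜] (Set.Icc (0 : ℝ) 1 → 𝕜) where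
  toFun := toFun
  map_add' := toFun_add
  map_smul' := toFun_smul

theorem norm_apply_le (f : HolderSpace 𝕜 (Set.Icc (0 : ℝ) 1) 𝕜 α) (x : Set.Icc (0 : ℝ) 1) :
    ‖f.toFun x‖ ≤ ‖f‖ :=
  (le_ciSup f.bddAbove x).trans (by rw [norm_def]; simp)

theorem continuous_eval (x : Set.Icc (0 : ℝ) 1) :
    Continuous fun f : HolderSpace 𝕜 (Set.Icc (0 : ℝ) 1) 𝕜 α => f.toFun x :=
  let L : HolderSpace 𝕜 (Set.Icc (0 : ℝ) 1) 𝕜 α →ₗ[𝕜] 𝕜 :=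
    { toFun := fun f => f.toFun x, map_add' := fun _ _ => rfl, map_smul' := fun _ _ => rfl }
  (L.mkContinuous 1 fun f => by rw [one_mul]; exact norm_apply_le f x).continuous

end HolderSpace

end Improved

/-! ### Bumps of exact Hölder order on a sequence of adjacent intervals -/

section Bump

/-- The tent of slope one over the interval `(p k, p (k + 1))`. -/
def tent (p : ℕ → ℝ) (k : ℕ) (x : ℝ) : ℝ := min (x - p k) (p (k + 1) - x)

variable {p : ℕ → ℝ} {k l : ℕ} {x y : ℝ}

theorem tent_pos (hx : x ∈ Set.Ioo (p k) (p (k + 1))) : 0 < tent p k x :=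
  lt_min (sub_pos.2 hx.1) (sub_pos.2 hx.2)

theorem abs_tent_sub_tent_le : |tent p k x - tent p k y| ≤ |x - y| := by
  have := abs_min_sub_min_le_max (x - p k) (p (k + 1) - x) (y - p k) (p (k + 1) - y)
  refine this.trans (max_le (le_of_eq ?_) (le_of_eq ?_))
  · congr 1; ring
  · rw [abs_sub_comm]; congr 1; ring

/-- Inside its interval the tent is the distance to the complement; elsewhere it is nonpositive, so
`x` may be arbitrary. -/
theorem tent_le_abs_sub
    (hy : y ∉ Set.Ioo (p k) (p (k + 1))) : tent p k x ≤ |x - y| := by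
  rcases le_or_gt y (p k) with h | h
  · exact (min_le_left _ _).trans ((sub_le_sub_left h x).trans (le_abs_self _))
  · have h' : p (k + 1) ≤ y := le_of_not_gt fun h' => hy ⟨h, h'⟩
    rw [abs_sub_comm]
    exact (min_le_right _ _).trans ((sub_le_sub_right h' x).trans (le_abs_self _))

theorem eq_of_mem_Ioo_succ (hp : StrictMono p) (hk : x ∈ Set.Ioo (p k) (p (k + 1)))
    (hl : x ∈ Set.Ioo (p l) (p (l + 1))) : k = l := by
  by_contra h
  exact Set.disjoint_left.1 (hp.monotone.pairwise_disjoint_on_Ioo_succ h) hk hl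

/-- Makes bump functions vanish at the nodes, even for order zero, where the power of the tent there
would be `0 ^ 0 = 1`. -/
theorem notMem_Ioo_succ (hp : StrictMono p) (k l : ℕ) : p k ∉ Set.Ioo (p l) (p (l + 1)) := by
  rintro ⟨h₁, h₂⟩
  have := hp.lt_iff_lt.1 h₁
  have := hp.lt_iff_lt.1 h₂
  omega

variable {𝕜 : Type u} [RCLike 𝕜]

/-- `g` is the combination with coefficients `a k` of the powers of order `r` of the tents. -/
def IsBumpSeries (p : ℕ → ℝ) (r : ℝ) (a : ℕ → 𝕜) (g : ℝ → 𝕜) : Prop :=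
  (∀ k, ∀ x ∈ Set.Ioo (p k) (p (k + 1)), g x = a k * ((tent p k x ^ r : ℝ) : 𝕜)) ∧
    ∀ x, (∀ k, x ∉ Set.Ioo (p k) (p (k + 1))) → g x = 0

theorem exists_isBumpSeries (hp : StrictMono p) (r : ℝ) (a : ℕ → 𝕜) :
    ∃ g, IsBumpSeries p r a g := by
  classical
  refine ⟨fun x => if h : ∃ k, x ∈ Set.Ioo (p k) (p (k + 1)) then
    a h.choose * ((tent p h.choose x ^ r : ℝ) : 𝕜) else 0, fun k x hx => ?_, fun x hx => ?_⟩
  · have h : ∃ k, x ∈ Set.Ioo (p k) (p (k + 1)) := ⟨k, hx⟩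
    dsimp only
    rw [dif_pos h, eq_of_mem_Ioo_succ hp h.choose_spec hx]
  · exact dif_neg (not_exists.2 hx)

theorem norm_coe_rpow {t : ℝ} (ht : 0 ≤ t) (r : ℝ) : ‖((t ^ r : ℝ) : 𝕜)‖ = t ^ r := by
  rw [RCLike.norm_ofReal, abs_of_nonneg (Real.rpow_nonneg ht r)]

variable {r A : ℝ} {a : ℕ → 𝕜} {g : ℝ → 𝕜}

theorem IsBumpSeries.norm_le_of_separated (hg : IsBumpSeries p r a g) (hr : 0 ≤ r)
    (ha : ∀ k, ‖a k‖ ≤ A) (hxy : ∀ k, x ∈ Set.Ioo (p k) (p (k + 1)) →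
      y ∉ Set.Ioo (p k) (p (k + 1))) : ‖g x‖ ≤ A * |x - y| ^ r := by
  have hA : 0 ≤ A := (norm_nonneg _).trans (ha 0)
  by_cases h : ∃ k, x ∈ Set.Ioo (p k) (p (k + 1))
  · obtain ⟨k, hk⟩ := h
    rw [hg.1 k x hk, norm_mul, norm_coe_rpow (tent_pos hk).le]
    exact mul_le_mul (ha k) (Real.rpow_le_rpow (tent_pos hk).le
      (tent_le_abs_sub (hxy k hk)) hr) (Real.rpow_nonneg (tent_pos hk).le r) hA
  · rw [hg.2 x (not_exists.1 h), norm_zero]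
    positivity

/-- Within one interval this is subadditivity of `t ^ r`. Otherwise each value is bounded
separately, which costs the factor `2`. -/
theorem IsBumpSeries.norm_sub_le (hg : IsBumpSeries p r a g) (hr : 0 ≤ r)
    (hr1 : r ≤ 1) (ha : ∀ k, ‖a k‖ ≤ A) (x y : ℝ) : ‖g x - g y‖ ≤ 2 * A * |x - y| ^ r := by
  have hA : 0 ≤ A := (norm_nonneg _).trans (ha 0)
  by_cases h : ∃ k, x ∈ Set.Ioo (p k) (p (k + 1)) ∧ y ∈ Set.Ioo (p k) (p (k + 1))
  · obtain ⟨k, hx, hy⟩ := h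
    rw [hg.1 k x hx, hg.1 k y hy, ← mul_sub, ← RCLike.ofReal_sub, norm_mul, RCLike.norm_ofReal]
    have h₁ : |tent p k x ^ r - tent p k y ^ r| ≤ |x - y| ^ r :=
      (Real.abs_rpow_sub_rpow_le (tent_pos hx).le (tent_pos hy).le hr hr1).trans
        (Real.rpow_le_rpow (abs_nonneg _) abs_tent_sub_tent_le hr)
    calc _ ≤ A * |x - y| ^ r := mul_le_mul (ha k) h₁ (abs_nonneg _) hA
      _ ≤ 2 * A * |x - y| ^ r := by
        have : 0 ≤ A * |x - y| ^ r := by positivity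
        linarith
  · have h₁ := hg.norm_le_of_separated (y := y) hr ha fun k hk hk' => h ⟨k, hk, hk'⟩
    have h₂ := hg.norm_le_of_separated (x := y) (y := x) hr ha fun k hk hk' => h ⟨k, hk', hk⟩
    rw [abs_sub_comm] at h₂
    linarith [_root_.norm_sub_le (g x) (g y)]

variable {α : ℝ≥0}

theorem IsBumpSeries.mem_holderSubmodule (hg : IsBumpSeries p α a g) (hp : StrictMono p)
    (hp01 : ∀ k, p k ∈ Set.Icc (0 : ℝ) 1) (hα : α ≤ 1) (ha : ∀ k, ‖a k‖ ≤ A) :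
    (fun x : Set.Icc (0 : ℝ) 1 => g x) ∈ holderSubmodule 𝕜 (Set.Icc (0 : ℝ) 1) 𝕜 α := by
  have hA : 0 ≤ A := (norm_nonneg _).trans (ha 0)
  have hα' : (α : ℝ) ≤ 1 := by exact_mod_cast hα
  have h := hg.norm_sub_le α.coe_nonneg hα' ha
  refine ⟨⟨2 * A, fun x => ?_⟩, memHolder_of_norm_sub_le (by positivity : 0 ≤ 2 * A) fun x y => ?_⟩
  · have h0 : g (p 0) = 0 := hg.2 _ fun l => notMem_Ioo_succ hp 0 l
    have h1 := h x (p 0)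
    rw [h0, sub_zero] at h1
    refine h1.trans (mul_le_of_le_one_right (by positivity)
      (Real.rpow_le_one (abs_nonneg _) ?_ α.coe_nonneg))
    exact unitInterval_dist_le_one x ⟨p 0, hp01 0⟩
  · exact h x y

variable (𝕜 α p) in
/-- The functions in the Hölder space that are proportional to the bump on each of the intervals
`(p k, p (k + 1))` and vanish elsewhere. -/
def bumpSubmodule : Submodule 𝕜 (HolderSpace 𝕜 (Set.Icc (0 : ℝ) 1) 𝕜 α) where
  carrier := {f | (∀ k, ∀ x y : Set.Icc (0 : ℝ) 1, (x : ℝ) ∈ Set.Ioo (p k) (p (k + 1)) →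
      (y : ℝ) ∈ Set.Ioo (p k) (p (k + 1)) →
        f.toFun x * ((tent p k y ^ (α : ℝ) : ℝ) : 𝕜) =
          f.toFun y * ((tent p k x ^ (α : ℝ) : ℝ) : 𝕜)) ∧
    ∀ x : Set.Icc (0 : ℝ) 1, (∀ k, (x : ℝ) ∉ Set.Ioo (p k) (p (k + 1))) → f.toFun x = 0}
  zero_mem' := by
    have h : ∀ x, (0 : HolderSpace 𝕜 (Set.Icc (0 : ℝ) 1) 𝕜 α).toFun x = 0 := fun _ => rfl
    simp [h]
  add_mem' := by
    rintro f g ⟨hf, hf'⟩ ⟨hg, hg'⟩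
    refine ⟨fun k x y hx hy => ?_, fun x hx => ?_⟩
    · simp only [HolderSpace.toFun_add, Pi.add_apply, add_mul, hf k x y hx hy, hg k x y hx hy]
    · simp only [HolderSpace.toFun_add, Pi.add_apply, hf' x hx, hg' x hx, add_zero]
  smul_mem' := by
    rintro c f ⟨hf, hf'⟩
    refine ⟨fun k x y hx hy => ?_, fun x hx => ?_⟩
    · simp only [HolderSpace.toFun_smul, Pi.smul_apply, smul_eq_mul, mul_assoc, hf k x y hx hy]
    · simp only [HolderSpace.toFun_smul, Pi.smul_apply, hf' x hx, smul_zero]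

/-- Proportionality is stated in cross-multiplied form, so each condition is an equation between
continuous point evaluations. -/
theorem isClosed_bumpSubmodule :
    IsClosed (bumpSubmodule p 𝕜 α : Set (HolderSpace 𝕜 (Set.Icc (0 : ℝ) 1) 𝕜 α)) := by
  have h : (bumpSubmodule p 𝕜 α : Set (HolderSpace 𝕜 (Set.Icc (0 : ℝ) 1) 𝕜 α)) =
      (⋂ (k : ℕ) (x : Set.Icc (0 : ℝ) 1) (y : Set.Icc (0 : ℝ) 1)
        (_ : (x : ℝ) ∈ Set.Ioo (p k) (p (k + 1))) (_ : (y : ℝ) ∈ Set.Ioo (p k) (p (k + 1))),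
        {f | f.toFun x * ((tent p k y ^ (α : ℝ) : ℝ) : 𝕜) =
          f.toFun y * ((tent p k x ^ (α : ℝ) : ℝ) : 𝕜)}) ∩
      ⋂ (x : Set.Icc (0 : ℝ) 1) (_ : ∀ k, (x : ℝ) ∉ Set.Ioo (p k) (p (k + 1))),
        {f | f.toFun x = 0} := by
    ext f
    simp only [Set.mem_inter_iff, Set.mem_iInter]
    rfl
  rw [h]
  refine IsClosed.inter ?_ ?_
  · exact isClosed_iInter fun k => isClosed_iInter fun x => isClosed_iInter fun y =>
      isClosed_iInter fun _ => isClosed_iInter fun _ => isClosed_eq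
        ((HolderSpace.continuous_eval x).mul_const _) ((HolderSpace.continuous_eval y).mul_const _)
  · exact isClosed_iInter fun x => isClosed_iInter fun _ =>
      isClosed_eq (HolderSpace.continuous_eval x) continuous_const

/-- The midpoint of the `k`-th interval. -/
noncomputable def bumpMid (hp01 : ∀ k, p k ∈ Set.Icc (0 : ℝ) 1) (k : ℕ) : Set.Icc (0 : ℝ) 1 :=
  ⟨(p k + p (k + 1)) / 2, by
    constructor <;> linarith [(hp01 k).1, (hp01 k).2, (hp01 (k + 1)).1, (hp01 (k + 1)).2]⟩

theorem bumpMid_mem (hp : StrictMono p) (hp01 : ∀ k, p k ∈ Set.Icc (0 : ℝ) 1) (k : ℕ) :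
    (bumpMid hp01 k : ℝ) ∈ Set.Ioo (p k) (p (k + 1)) := by
  have := hp (Nat.lt_succ_self k)
  simp only [bumpMid]
  constructor <;> simp only [Nat.succ_eq_add_one] at this <;> linarith

theorem tent_bumpMid_ne_zero (hp : StrictMono p) (hp01 : ∀ k, p k ∈ Set.Icc (0 : ℝ) 1) (k : ℕ) :
    ((tent p k (bumpMid hp01 k) ^ (α : ℝ) : ℝ) : 𝕜) ≠ 0 :=
  RCLike.ofReal_ne_zero.2 (Real.rpow_pos_of_pos (tent_pos (bumpMid_mem hp hp01 k)) _).ne'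

variable (𝕜 α) in
/-- The coefficients of a function with respect to the bumps. -/
noncomputable def bumpCoeff (hp01 : ∀ k, p k ∈ Set.Icc (0 : ℝ) 1) :
    bumpSubmodule p 𝕜 α →ₗ[𝕜] (ℕ → 𝕜) :=
  LinearMap.pi fun k => (((tent p k (bumpMid hp01 k) ^ (α : ℝ) : ℝ) : 𝕜)⁻¹ •
    (LinearMap.proj (bumpMid hp01 k) ∘ₗ HolderSpace.toFunLinear 𝕜 α)) ∘ₗ
      (bumpSubmodule p 𝕜 α).subtype

theorem bumpCoeff_apply (hp01 : ∀ k, p k ∈ Set.Icc (0 : ℝ) 1) (f : bumpSubmodule p 𝕜 α) (k : ℕ) :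
    bumpCoeff 𝕜 α hp01 f k =
      ((tent p k (bumpMid hp01 k) ^ (α : ℝ) : ℝ) : 𝕜)⁻¹ * f.1.toFun (bumpMid hp01 k) := rfl

theorem toFun_eq_bumpCoeff_mul (hp : StrictMono p) (hp01 : ∀ k, p k ∈ Set.Icc (0 : ℝ) 1)
    (f : bumpSubmodule p 𝕜 α) (k : ℕ) (x : Set.Icc (0 : ℝ) 1)
    (hx : (x : ℝ) ∈ Set.Ioo (p k) (p (k + 1))) :
    f.1.toFun x = bumpCoeff 𝕜 α hp01 f k * ((tent p k x ^ (α : ℝ) : ℝ) : 𝕜) := by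
  rw [bumpCoeff_apply, mul_assoc, ← f.2.1 k x _ hx (bumpMid_mem hp hp01 k), mul_comm (f.1.toFun x),
    inv_mul_cancel_left₀ (tent_bumpMid_ne_zero hp hp01 k)]

theorem eq_zero_of_bumpCoeff (hp : StrictMono p) (hp01 : ∀ k, p k ∈ Set.Icc (0 : ℝ) 1)
    (f : bumpSubmodule p 𝕜 α) (h : ∀ k, bumpCoeff 𝕜 α hp01 f k = 0) : f = 0 := by
  refine Subtype.ext (HolderSpace.ext_toFun (funext fun x => ?_))
  change f.1.toFun x = 0
  by_cases hx : ∃ k, (x : ℝ) ∈ Set.Ioo (p k) (p (k + 1))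
  · obtain ⟨k, hk⟩ := hx
    rw [toFun_eq_bumpCoeff_mul hp hp01 f k x hk, h, zero_mul]
  · exact f.2.2 x (not_exists.1 hx)

theorem exists_bumpCoeff_eq (hp : StrictMono p) (hp01 : ∀ k, p k ∈ Set.Icc (0 : ℝ) 1)
    (hα : α ≤ 1) (ha : ∀ k, ‖a k‖ ≤ A) :
    ∃ f : bumpSubmodule p 𝕜 α, bumpCoeff 𝕜 α hp01 f = a := by
  obtain ⟨g, hg⟩ := exists_isBumpSeries hp (α : ℝ) a
  let G : HolderSpace 𝕜 (Set.Icc (0 : ℝ) 1) 𝕜 α :=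
    ⟨fun x => g x, hg.mem_holderSubmodule hp hp01 hα ha⟩
  have hG : ∀ x, G.toFun x = g x := fun _ => rfl
  refine ⟨⟨G, fun k x y hx hy => ?_, fun x hx => ?_⟩, funext fun k => ?_⟩
  · rw [hG, hG, hg.1 k x hx, hg.1 k y hy]
    ring
  · rw [hG, hg.2 x hx]
  · rw [bumpCoeff_apply]
    change _ * G.toFun _ = _
    rw [hG, hg.1 k _ (bumpMid_mem hp hp01 k), mul_comm, mul_assoc,
      mul_inv_cancel₀ (tent_bumpMid_ne_zero hp hp01 k), mul_one]

/-- The coefficients embed the space into the sequences, of dimension at most `𝔠`; the bounded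
geometric sequences are all attained. -/
theorem rank_bumpSubmodule (hp : StrictMono p) (hp01 : ∀ k, p k ∈ Set.Icc (0 : ℝ) 1)
    (hα : α ≤ 1) : Module.rank 𝕜 (bumpSubmodule p 𝕜 α) = 𝔠 := by
  refine le_antisymm ?_ ?_
  · refine (LinearMap.rank_le_of_injective (bumpCoeff 𝕜 α hp01) ?_).trans
      (rank_nat_fun_le_continuum 𝕜)
    refine (injective_iff_map_eq_zero _).2 fun f hf => ?_
    exact eq_zero_of_bumpCoeff hp hp01 f fun k => congrFun hf k
  · have h : ∀ t : Set.Ioo (0 : ℝ) 1, ∃ f : bumpSubmodule p 𝕜 α,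
        bumpCoeff 𝕜 α hp01 f = fun k => ((t : ℝ) : 𝕜) ^ k := fun t => by
      refine exists_bumpCoeff_eq hp hp01 hα (A := 1) fun k => ?_
      rw [norm_pow, RCLike.norm_ofReal, abs_of_pos t.2.1]
      exact pow_le_one₀ t.2.1.le t.2.2.le
    choose F hF using h
    have hind : LinearIndependent 𝕜 F := by
      refine LinearIndependent.of_comp (bumpCoeff 𝕜 α hp01) ?_
      convert linearIndependent_geometric 𝕜 using 1
      exact funext hF
    simpa [Cardinal.mk_Ioo_real] using hind.cardinal_lift_le_rank

/-- Nonzero combinations of bumps have no better Hölder regularity. -/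
theorem bumpSubmodule_eq_zero_of_improvedOn (hp : StrictMono p)
    (hp01 : ∀ k, p k ∈ Set.Icc (0 : ℝ) 1) (f : bumpSubmodule p 𝕜 α)
    (hf : f.1.toFun ∈ improvedOn 𝕜 α Set.univ) : f = 0 := by
  refine eq_zero_of_bumpCoeff hp hp01 f fun k => norm_le_zero_iff.1 ?_
  -- Just right of `p k` the function is `a s ^ α`, and it vanishes at `p k`; hence `‖a‖ ≤ C s ^ (β
  -- - α)`, which tends to zero with `s`.
  obtain ⟨β, hβ, C, -, hC⟩ := hf
  have hβ' : 0 < (β : ℝ) - α := sub_pos.2 hβ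
  have hpk : f.1.toFun ⟨p k, hp01 k⟩ = 0 := f.2.2 _ fun l => notMem_Ioo_succ hp k l
  -- Up to half the length, the tent is on its rising side and equals `s`.
  have hd : 0 < (p (k + 1) - p k) / 2 := half_pos (sub_pos.2 (hp (Nat.lt_succ_self k)))
  have hlim : Filter.Tendsto (fun s : ℝ => C * s ^ ((β : ℝ) - α)) (nhdsWithin 0 (Set.Ioi 0))
      (nhds 0) := by
    have h : ContinuousAt (fun s : ℝ => C * s ^ ((β : ℝ) - α)) 0 :=
      continuousAt_const.mul (Real.continuousAt_rpow_const _ _ (Or.inr hβ'.le))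
    have h' := h.tendsto
    rw [Real.zero_rpow hβ'.ne', mul_zero] at h'
    exact h'.mono_left nhdsWithin_le_nhds
  refine ge_of_tendsto hlim ?_
  filter_upwards [Ioo_mem_nhdsGT hd] with s hs
  have hxI : p k + s ∈ Set.Ioo (p k) (p (k + 1)) := by
    constructor <;> linarith [hs.1, hs.2]
  have hx01 : p k + s ∈ Set.Icc (0 : ℝ) 1 := by
    constructor <;> linarith [(hp01 k).1, (hp01 (k + 1)).2, hxI.1, hxI.2]
  have htent : tent p k (p k + s) = s := by
    rw [tent, add_sub_cancel_left, min_eq_left]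
    linarith [hs.2]
  have h := hC ⟨p k + s, hx01⟩ ⟨p k, hp01 k⟩ trivial trivial
  have hdist : dist (⟨p k + s, hx01⟩ : Set.Icc (0 : ℝ) 1) ⟨p k, hp01 k⟩ = s := by
    rw [Subtype.dist_eq, Real.dist_eq, add_sub_cancel_left, abs_of_pos hs.1]
  rw [hpk, sub_zero, toFun_eq_bumpCoeff_mul hp hp01 f k _ hxI, hdist, norm_mul] at h
  simp only [htent] at h
  rw [norm_coe_rpow hs.1.le] at h
  have hsα := Real.rpow_pos_of_pos hs.1 (α : ℝ)
  rw [Real.rpow_sub hs.1, ← mul_div_assoc, le_div_iff₀ hsα]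
  exact h

end Bump

/-! ### Enlarging finite-dimensional subspaces and perturbing infinite-dimensional ones -/

section Main

variable {𝕜 : Type u} [RCLike 𝕜] {α : ℝ≥0}

theorem mem_improvedOn_univ_of_mem_strictHolderSet_union
    {f : HolderSpace 𝕜 (Set.Icc (0 : ℝ) 1) 𝕜 α} (h : f ∈ strictHolderSet 𝕜 α ∪ {0})
    (hf : f.toFun ∈ improvedOn 𝕜 α Set.univ) : f = 0 :=
  h.resolve_left fun h' => mem_strictHolderSet_iff.1 h' hf

theorem mem_strictHolderSet_union_of_imp {f : HolderSpace 𝕜 (Set.Icc (0 : ℝ) 1) 𝕜 α}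
    (h : f.toFun ∈ improvedOn 𝕜 α Set.univ → f = 0) : f ∈ strictHolderSet 𝕜 α ∪ {0} := by
  by_cases hf : f.toFun ∈ improvedOn 𝕜 α Set.univ
  · exact Or.inr (h hf)
  · exact Or.inl (mem_strictHolderSet_iff.2 hf)

/-- For a finite-dimensional space of functions without better Hölder regularity, there is an
interval off which none of its nonzero members has better regularity. -/
theorem exists_interval_eq_zero_of_improvedOn
    (F : Submodule 𝕜 (HolderSpace 𝕜 (Set.Icc (0 : ℝ) 1) 𝕜 α)) [FiniteDimensional 𝕜 F]
    (hF : (F : Set _) ⊆ strictHolderSet 𝕜 α ∪ {0}) :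
    ∃ a b : ℝ, 0 ≤ a ∧ a < b ∧ b ≤ 1 ∧
      ∀ f ∈ F, (∀ S : Set ℝ, Disjoint S (Set.Ioo a b) → f.toFun ∈ improvedOn 𝕜 α S) → f = 0 := by
  -- One interval more than the dimension, so that a subfamily of at most `finrank` pieces omits
  -- one.
  set M := Module.finrank 𝕜 F + 1 with hM
  have hM0 : (0 : ℝ) < M := by positivity
  let W : ℕ → Submodule 𝕜 F := fun j =>
    (improvedOn 𝕜 α (Set.Icc (j / M : ℝ) ((j + 1 : ℕ) / M))).comap
      (HolderSpace.toFunLinear 𝕜 α ∘ₗ F.subtype)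
  obtain ⟨t, hts, hcard, hinf⟩ := Submodule.exists_subset_finset_inf_eq W (Finset.range M)
  have hbot : t.inf W = ⊥ := by
    rw [hinf, eq_bot_iff]
    intro f hf
    rw [Submodule.mem_finsetInf] at hf
    exact Subtype.ext (mem_improvedOn_univ_of_mem_strictHolderSet_union (hF f.2)
      (mem_improvedOn_univ_of_subdivision (Nat.succ_pos _) fun j hj => hf j (Finset.mem_range.2 hj)))
  obtain ⟨i, hi, hit⟩ : ∃ i ∈ Finset.range M, i ∉ t := by
    refine Finset.exists_mem_notMem_of_card_lt_card ?_
    rw [Finset.card_range]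
    omega
  refine ⟨i / M, (i + 1 : ℕ) / M, by positivity, ?_, ?_, fun f hfF hf => ?_⟩
  · gcongr
    omega
  · rw [div_le_one hM0]
    exact_mod_cast Finset.mem_range.1 hi
  · have hmem : (⟨f, hfF⟩ : F) ∈ t.inf W := by
      rw [Submodule.mem_finsetInf]
      intro j hj
      -- The other closed pieces meet the omitted one at most in its endpoints, hence the open
      -- interval.
      refine hf _ (Set.disjoint_left.2 fun x hx hx' => ?_)
      rcases lt_or_gt_of_ne (show j ≠ i from fun h => hit (h ▸ hj)) with h | h
      · have : ((j + 1 : ℕ) / M : ℝ) ≤ i / M := by gcongr; omega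
        linarith [hx.2, hx'.1]
      · have : ((i + 1 : ℕ) / M : ℝ) ≤ j / M := by gcongr; omega
        linarith [hx.1, hx'.2]
    rw [hbot, Submodule.mem_bot] at hmem
    exact congrArg Subtype.val hmem

/-- A finite-dimensional space of functions without better Hölder regularity lies in a closed one
of dimension `𝔠`, which contains a space of bumps. -/
theorem exists_isClosed_rank_eq_continuum (hα : α ≤ 1)
    (F : Submodule 𝕜 (HolderSpace 𝕜 (Set.Icc (0 : ℝ) 1) 𝕜 α)) [FiniteDimensional 𝕜 F]
    (hF : (F : Set _) ⊆ strictHolderSet 𝕜 α ∪ {0}) :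
    ∃ G : Submodule 𝕜 (HolderSpace 𝕜 (Set.Icc (0 : ℝ) 1) 𝕜 α), Module.rank 𝕜 G = 𝔠 ∧
      IsClosed (G : Set (HolderSpace 𝕜 (Set.Icc (0 : ℝ) 1) 𝕜 α)) ∧ F ≤ G ∧
        (G : Set _) ⊆ strictHolderSet 𝕜 α ∪ {0} := by
  obtain ⟨a, b, ha, hab, hb, hFab⟩ := exists_interval_eq_zero_of_improvedOn F hF
  obtain ⟨p, hp, hpab, -⟩ := exists_seq_strictMono_tendsto' hab
  have hp01 : ∀ k, p k ∈ Set.Icc (0 : ℝ) 1 := fun k =>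
    ⟨ha.trans (hpab k).1.le, (hpab k).2.le.trans hb⟩
  have hrank := rank_bumpSubmodule (𝕜 := 𝕜) hp hp01 hα
  refine ⟨bumpSubmodule p 𝕜 α ⊔ F, le_antisymm ?_ ?_,
    Submodule.isClosed_sup_finiteDimensional _ _ isClosed_bumpSubmodule, le_sup_right, ?_⟩
  · refine (Submodule.rank_add_le_rank_add_rank _ _).trans ?_
    rw [hrank]
    exact (Cardinal.add_le_max _ _).trans (max_le (max_le le_rfl
      ((Module.rank_lt_aleph0 𝕜 F).le.trans Cardinal.aleph0_le_continuum)) Cardinal.aleph0_le_continuum)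
  · rw [← hrank]
    exact Submodule.rank_mono le_sup_left
  · intro h hh
    obtain ⟨g, hg, f, hf, rfl⟩ := Submodule.mem_sup.1 hh
    refine mem_strictHolderSet_union_of_imp fun himp => ?_
    have hf0 : f = 0 := hFab f hf fun S hS => by
      have hgS : g.toFun ∈ improvedOn 𝕜 α S := by
        refine mem_improvedOn_of_eq_const (c := 0) fun x hx => hg.2 x fun k hk => ?_
        exact Set.disjoint_left.1 hS hx
          ⟨(hpab k).1.trans hk.1, hk.2.trans (hpab (k + 1)).2⟩
      have hsum : (g + f).toFun ∈ improvedOn 𝕜 α S := improvedOn_mono (Set.subset_univ S) himp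
      have := sub_mem hsum hgS
      rwa [HolderSpace.toFun_add, add_sub_cancel_left] at this
    subst hf0
    rw [add_zero] at himp ⊢
    exact congrArg Subtype.val (bumpSubmodule_eq_zero_of_improvedOn hp hp01 ⟨g, hg⟩ himp)

/-- An infinite-dimensional space of functions without better Hölder regularity can be replaced
by one of the same dimension whose closure contains a nonzero constant. -/
theorem exists_rank_eq_not_isClosed
    (F : Submodule 𝕜 (HolderSpace 𝕜 (Set.Icc (0 : ℝ) 1) 𝕜 α)) (hinf : ℵ₀ ≤ Module.rank 𝕜 F)
    (hF : (F : Set _) ⊆ strictHolderSet 𝕜 α ∪ {0}) :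
    ∃ F' : Submodule 𝕜 (HolderSpace 𝕜 (Set.Icc (0 : ℝ) 1) 𝕜 α),
      Module.rank 𝕜 F' = Module.rank 𝕜 F ∧ (F' : Set _) ⊆ strictHolderSet 𝕜 α ∪ {0} ∧
      ∀ G : Submodule 𝕜 (HolderSpace 𝕜 (Set.Icc (0 : ℝ) 1) 𝕜 α),
        IsClosed (G : Set (HolderSpace 𝕜 (Set.Icc (0 : ℝ) 1) 𝕜 α)) → F' ≤ G →
          ¬ (G : Set _) ⊆ strictHolderSet 𝕜 α ∪ {0} := by
  obtain ⟨φ, hφ⟩ := exists_linearMap_eq_one_norm_lt hinf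
  let one : HolderSpace 𝕜 (Set.Icc (0 : ℝ) 1) 𝕜 α :=
    ⟨fun _ => 1, ⟨1, fun _ => by simp⟩, memHolder_const'⟩
  have hone : ∀ c : 𝕜, (c • one).toFun ∈ improvedOn 𝕜 α Set.univ := fun c =>
    mem_improvedOn_of_eq_const (c := c • 1) fun _ _ => rfl
  have hone0 : one ≠ 0 := fun h =>
    one_ne_zero (congrFun (congrArg HolderSpace.toFun h) ⟨0, by simp⟩ : (1 : 𝕜) = 0)
  let T : F →ₗ[𝕜] HolderSpace 𝕜 (Set.Icc (0 : ℝ) 1) 𝕜 α := F.subtype + φ.smulRight one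
  have hT : ∀ x, T x = x + φ x • one := fun _ => rfl
  have himp : ∀ x, (T x).toFun ∈ improvedOn 𝕜 α Set.univ → x = 0 := fun x hx => by
    refine Subtype.ext (mem_improvedOn_univ_of_mem_strictHolderSet_union (hF x.2) ?_)
    have := sub_mem hx (hone (φ x))
    rwa [hT, HolderSpace.toFun_add, add_sub_cancel_right] at this
  have hinj : Function.Injective T := (injective_iff_map_eq_zero T).2 fun x hx =>
    himp x (by rw [hx]; exact zero_mem _)
  refine ⟨LinearMap.range T, (LinearEquiv.ofInjective T hinj).rank_eq.symm, ?_, ?_⟩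
  · rintro _ ⟨x, rfl⟩
    exact mem_strictHolderSet_union_of_imp fun h => by rw [himp x h, map_zero]
  · intro G hG hle hsub
    have hmem : one ∈ G := by
      refine hG.closure_subset (Metric.mem_closure_iff.2 fun ε hε => ?_)
      obtain ⟨x, hx, hx1⟩ := hφ ε hε
      -- Since `φ x = 1`, `T x = x + one` is within `‖x‖ < ε` of `one`.
      refine ⟨T x, hle ⟨x, rfl⟩, ?_⟩
      rw [dist_comm, dist_eq_norm, hT, hx1, one_smul, add_sub_cancel_right]
      exact hx
    refine hone0 (mem_improvedOn_univ_of_mem_strictHolderSet_union (hsub hmem) ?_)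
    simpa using hone 1

end Main

theorem mainTheorem9 {𝕜 : Type u} [RCLike 𝕜] (α : ℝ≥0) (hα : α ≤ 1) (κ : Cardinal.{u}) :
    IsPairSpaceable 𝕜 κ Cardinal.continuum.{u} (strictHolderSet 𝕜 α) ↔ κ < Cardinal.aleph0 := by
  constructor
  · rintro ⟨-, ⟨F, hFκ, hF⟩, h⟩
    by_contra! hκ
    obtain ⟨F', hrank, hF', hnot⟩ := exists_rank_eq_not_isClosed F (hFκ ▸ hκ)
      (fun f hf => (em (f = 0)).elim Or.inr fun h0 => Or.inl (hF ⟨hf, h0⟩))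
    obtain ⟨G, -, hG, hle, hsub⟩ := h F' (hrank.trans hFκ) hF'
    exact hnot G hG hle hsub
  · intro hκ
    have hκc := hκ.trans Cardinal.aleph0_lt_continuum
    refine ⟨hκc, ?_, fun F hFκ hF => ?_⟩
    -- Enlarging the zero subspace yields a space of dimension `𝔠`, which has subspaces of dimension
    -- `κ`.
    · obtain ⟨G, hG, -, -, hsub⟩ := exists_isClosed_rank_eq_continuum (𝕜 := 𝕜) hα ⊥ (by simp)
      obtain ⟨F, hFG, hF⟩ := G.exists_le_rank_eq (hκc.le.trans hG.ge)
      exact ⟨F, hF, fun f hf => (hsub (hFG hf.1)).resolve_right hf.2⟩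
    · have : FiniteDimensional 𝕜 F := Module.rank_lt_aleph0_iff.1 (hFκ ▸ hκ)
      exact exists_isClosed_rank_eq_continuum hα F hF
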